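/- For every integer $m\ge 1$ let $K=\mathbb{Q}(\zeta_m)$ with ring of integers $\mathcal{O}_K$, let $\phi(m)=[K:\mathbb{Q}]$, let $\mathfrak{P}=\mathfrak{P}_m$ be a prime ideal of $\mathcal{O}_K$ lying over a prime number $p=p_m$ with $p\nmid m$, and let $F=\mathcal{O}_K/\mathfrak{P}$, a finite field with $q_m$ elements. Let $K_{\mathbb{R}}=K\otimes_{\mathbb{Q}}\mathbb{R}$ be the Euclidean space of dimension $\phi(m)$ with the scalar product induced by the trace form, $\langle x,y\rangle=\mathrm{tr}_{K/\mathbb{Q}}(x\overline{y})$ for $x,y\in K$, and let $E=K_{\mathbb{R}}^2$ be the orthogonal direct sum of two copies of it, a Euclidean space of dimension $2\phi(m)$. Let $\pi:\mathcal{O}_K^2\to F^2$ be reduction modulo $\mathfrak{P}$, and let $$\mathcal{L}_m=\{\pi^{-1}(C) : C \text{ an } F\text{-line of } F^2\},$$ where $\pi^{-1}(C)\subset\mathcal{O}_K^2$ is regarded as a subset of $E$ through the natural embedding $K\to K_{\mathbb{R}}$. For a lattice $\Lambda$ in a Euclidean space of dimension $n$, let $\mu_\Lambda=\min\{\|x\|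 : x\in\Lambda\setminus\{0\}\}$, let $\mathrm{Vol}(\Lambda)$ be the volume of a fundamental region of $\Lambda$, and let $$\Delta(\Lambda)=\frac{\mathrm{Vol}(B(\mu_\Lambda))}{2^n\,\mathrm{Vol}(\Lambda)}$$ be its packing density, where $B(r)$ is the closed ball of radius $r$. **Theorem.** Let $0<\varepsilon<1$. If $\phi(m)^2\,m=o\big(q_m^{1/\phi(m)}\big)$ as $m\to\infty$, then for all sufficiently large $m$ the set $\mathcal{L}_m$ consists of exactly $q_m+1$ lattices of $E\cong\mathbb{R}^{2\phi(m)}$ and contains a lattice $\Lambda$ satisfying $$\Delta(\Lambda)>\frac{(1-\varepsilon)\,m}{2^{2\phi(m)}}.$$ -/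

import Mathlib

open NumberField Module MeasureTheory Filter Asymptotics

noncomputable section

namespace CyclotomicLattices

section Lattices

variable {E : Type*} [NormedAddCommGroup E] [InnerProductSpace ℝ E] [FiniteDimensional ℝ E]
  [MeasurableSpace E] [BorelSpace E]

/-- A lattice of a Euclidean space: a discrete `ℤ`-submodule of full rank. -/
def IsLattice (Λ : Submodule ℤ E) : Prop :=
  ∃ _ : DiscreteTopology Λ, IsZLattice ℝ Λ

/-- The minimum of a lattice: the smallest norm of its nonzero vectors. -/
def minimum (Λ : Submodule ℤ E) : ℝ :=
  sInf {r : ℝ | ∃ x ∈ Λ, x ≠ 0 ∧ r = ‖x‖}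

/-- The density `Vol(B(μ)) / (2 ^ n Vol(Λ))` of the sphere packing by balls of radius `μ / 2`
centred at the points of `Λ`, where `μ` is the minimum of `Λ`, `n` is the dimension of `E`, and
`Vol(Λ)` is the volume of a fundamental region of `Λ`. -/
def density (Λ : Submodule ℤ E) : ℝ :=
  (volume : Measure E).real (Metric.closedBall 0 (minimum Λ)) /
    (2 ^ finrank ℝ E * ZLattice.covolume Λ (volume : Measure E))

end Lattices

section NumberFields

variable (K : Type*) [Field K] [NumberField K]

/-- The canonical embedding `x ↦ (σ x)_σ` of a number field into the Hermitian space indexed by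
its complex embeddings. -/
def hermitianEmbedding : K →+ PiLp 2 (fun _ : K →+* ℂ => ℂ) where
  toFun x := WithLp.toLp 2 (canonicalEmbedding K x)
  map_zero' := by simp
  map_add' x y := by simp

/-- The Euclidean space `K ⊗ ℝ`, realized as the real span of the image of `K` in the Hermitian
space indexed by the complex embeddings of `K`. The scalar product it inherits is
`⟨x, y⟩ = ∑ σ, σ x * conj (σ y)` on the elements of `K`, which is the trace form `tr (x * conj y)`
when `K` is a cyclotomic field. -/
def EuclideanK : Type _ :=
  Submodule.span ℝ (Set.range (hermitianEmbedding K))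

instance : NormedAddCommGroup (EuclideanK K) :=
  inferInstanceAs (NormedAddCommGroup (Submodule.span ℝ (Set.range (hermitianEmbedding K))))

instance : InnerProductSpace ℝ (EuclideanK K) :=
  inferInstanceAs (InnerProductSpace ℝ (Submodule.span ℝ (Set.range (hermitianEmbedding K))))

instance : FiniteDimensional ℝ (EuclideanK K) :=
  inferInstanceAs (FiniteDimensional ℝ (Submodule.span ℝ (Set.range (hermitianEmbedding K))))

instance : MeasurableSpace (EuclideanK K) := borel _

instance : BorelSpace (EuclideanK K) := ⟨rfl⟩

instance : SecondCountableTopology (EuclideanK K) := by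
  have : ProperSpace (EuclideanK K) := FiniteDimensional.proper ℝ _
  infer_instance

/-- The natural embedding of `K` into `K ⊗ ℝ`. -/
def embK : K →+ EuclideanK K where
  toFun x := ⟨hermitianEmbedding K x, Submodule.subset_span (Set.mem_range_self x)⟩
  map_zero' := Subtype.ext (map_zero (hermitianEmbedding K))
  map_add' x y := Subtype.ext (map_add (hermitianEmbedding K) x y)

/-- The Euclidean space `(K ⊗ ℝ) ^ s`, orthogonal direct sum of `s` copies of `K ⊗ ℝ`. -/
abbrev Ambient (s : ℕ) : Type _ := PiLp 2 (fun _ : Fin s => EuclideanK K)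

/-- The embedding of `(𝓞 K) ^ s` into `(K ⊗ ℝ) ^ s`; its image is the lattice `Λ₀`. -/
def embIntegers (s : ℕ) : (Fin s → 𝓞 K) →+ Ambient K s where
  toFun x := WithLp.toLp 2 (fun i => embK K (x i : K))
  map_zero' := by ext i : 1; simp
  map_add' x y := by ext i : 1; simp

variable {K}

/-- The canonical surjection `π : (𝓞 K) ^ s → (𝓞 K ⧸ 𝔓) ^ s`, reduction modulo `𝔓`. -/
def reduction (𝔓 : Ideal (𝓞 K)) (s : ℕ) : (Fin s → 𝓞 K) →+ (Fin s → 𝓞 K ⧸ 𝔓) where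
  toFun x := fun i => Ideal.Quotient.mk 𝔓 (x i)
  map_zero' := by ext i; simp
  map_add' x y := by ext i; simp

/-- The lattice `Λ_C = π⁻¹(C)` obtained from a code `C` by Construction A. -/
def codeLattice (𝔓 : Ideal (𝓞 K)) {s : ℕ} (C : Submodule (𝓞 K ⧸ 𝔓) (Fin s → 𝓞 K ⧸ 𝔓)) :
    Submodule ℤ (Ambient K s) :=
  AddSubgroup.toIntSubmodule
    ((C.toAddSubgroup.comap (reduction 𝔓 s)).map (embIntegers K s))

/-- The family of the lattices `Λ_C`, for `C` running over the lines of `(𝓞 K ⧸ 𝔓) ^ 2`. -/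
def lineFamily (𝔓 : Ideal (𝓞 K)) : Set (Submodule ℤ (Ambient K 2)) :=
  {Λ | ∃ C : Submodule (𝓞 K ⧸ 𝔓) (Fin 2 → 𝓞 K ⧸ 𝔓),
    finrank (𝓞 K ⧸ 𝔓) C = 1 ∧ Λ = codeLattice 𝔓 C}

end NumberFields

end CyclotomicLattices

end

/-! Write `n = φ(m)`, `q` for the norm of `𝔓`, `Λ₀` for the image of `𝓞 K ^ 2`, `V` for its covolume
and `B` for the volume of the unit ball in dimension `2n`. Every line lattice has covolume `qV`, so
it suffices to find one without nonzero vectors of norm at most `r`, where `B r^(2n) = (1 - ε/2) m q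
V`.

Suppose each of the `q + 1` lines had such a short vector. By the arithmetic-geometric mean
inequality (`absNorm_sq_le_norm_embK_pow`) none of them lies in `𝔓 ^ 2`, so each reduction is
nonzero and determines its line. Multiplication by the `m` powers of `ζ` preserves norms and lines,
whence `(q + 1) m` distinct points of `Λ₀` in the ball of radius `r` (`mul_card_mul_covolume_le`).
Since `Λ₀` has covering radius at most `n`, this gives `(q + 1) m V ≤ B (r + n)^(2n)`.

The growth hypothesis makes `r` large against `n²`, so replacing `r` by `r + n` costs at most the
factor `1 / (1 - ε/2)` and the right side is at most `m q V`: a contradiction. `exists_radius`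
contains these estimates; they need only crude bounds on `V`, from Minkowski's theorem below and
from the covering radius above. -/

noncomputable section
namespace CyclotomicLattices

/-! ### Lattices in Euclidean spaces: rounding, point counting, Minkowski -/

section Euclidean

variable {E : Type*} [NormedAddCommGroup E] [InnerProductSpace ℝ E]

/-- Rounding the coefficients of a linear combination one at a time, each time in the favourable
direction, costs at most a quarter of the sum of the squared norms. -/
theorem exists_int_norm_sq_sum_le {ι : Type*} (s : Finset ι) (v : ι → E) (c : ι → ℝ) :
    ∃ z : ι → ℤ, ‖∑ i ∈ s, (c i - z i) • v i‖ ^ 2 ≤ (∑ i ∈ s, ‖v i‖ ^ 2) / 4 := by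
  classical
  induction s using Finset.induction_on with
  | empty => exact ⟨0, by simp⟩
  | insert a s ha ih =>
    obtain ⟨z, hz⟩ := ih
    set w := ∑ i ∈ s, (c i - z i) • v i with hw
    set t := Int.fract (c a) with ht
    have h0 : 0 ≤ t := Int.fract_nonneg _
    have h1 : t < 1 := Int.fract_lt_one _
    have key : ∀ k : ℤ, ‖∑ i ∈ insert a s, (c i - Function.update z a k i) • v i‖ ^ 2
        = ‖w‖ ^ 2 + 2 * (c a - k) * inner ℝ (v a) w + (c a - k) ^ 2 * ‖v a‖ ^ 2 := by
      intro k
      have : ∑ i ∈ s, (c i - Function.update z a k i) • v i = w := by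
        refine Finset.sum_congr rfl fun i hi => ?_
        rw [Function.update_of_ne (ne_of_mem_of_not_mem hi ha)]
      rw [Finset.sum_insert ha, this, Function.update_self, norm_add_sq_real, inner_smul_left,
        norm_smul, mul_pow, Real.norm_eq_abs, sq_abs]
      simp only [conj_trivial]
      ring
    have e0 : c a - (⌊c a⌋ : ℤ) = t := rfl
    have e1 : c a - ((⌊c a⌋ + 1 : ℤ) : ℝ) = t - 1 := by push_cast; rw [← e0]; ring
    have hva : 0 ≤ ‖v a‖ ^ 2 := by positivity
    rw [Finset.sum_insert ha]
    by_contra! hcon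
    have c0 := hcon (Function.update z a ⌊c a⌋)
    have c1 := hcon (Function.update z a (⌊c a⌋ + 1))
    rw [key, e0] at c0
    rw [key, e1] at c1
    -- Average the two roundings with weights `1 - t` (down) and `t` (up): the inner products
    -- cancel, leaving `‖w‖² + t(1 - t)‖v a‖²`.
    have k0 := mul_le_mul_of_nonneg_left c0.le (sub_nonneg.2 h1.le)
    have k1 := mul_le_mul_of_nonneg_left c1.le h0
    have : t * (1 - t) * ‖v a‖ ^ 2 ≤ 1 / 4 * ‖v a‖ ^ 2 := by
      gcongr
      nlinarith [sq_nonneg (t - 1 / 2)]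
    rcases h0.eq_or_lt with h | h
    · rw [← h] at c0
      nlinarith
    · have k1 := mul_lt_mul_of_pos_left c1 h
      nlinarith

theorem exists_mem_span_int_norm_sub_sq_le {ι : Type*} [Fintype ι] {v : ι → E}
    (hv : Submodule.span ℝ (Set.range v) = ⊤) (y : E) :
    ∃ x ∈ Submodule.span ℤ (Set.range v), ‖y - x‖ ^ 2 ≤ (∑ i, ‖v i‖ ^ 2) / 4 := by
  have hy : y ∈ Submodule.span ℝ (Set.range v) := hv ▸ Submodule.mem_top
  obtain ⟨c, rfl⟩ := (Submodule.mem_span_range_iff_exists_fun ℝ).1 hy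
  obtain ⟨z, hz⟩ := exists_int_norm_sq_sum_le Finset.univ v c
  refine ⟨∑ i, z i • v i, Submodule.sum_mem _ fun i _ =>
    Submodule.smul_mem _ _ (Submodule.subset_span (Set.mem_range_self i)), ?_⟩
  rw [← Finset.sum_sub_distrib]
  simpa only [sub_smul, Int.cast_smul_eq_zsmul] using hz

theorem isLattice_of_smul_mem (L M : Submodule ℤ E) [DiscreteTopology L] [IsZLattice ℝ L]
    (h : M ≤ L) {k : ℤ} (hk : k ≠ 0) (hM : ∀ x ∈ L, k • x ∈ M) : IsLattice M := by
  have : DiscreteTopology M := DiscreteTopology.of_subset (s := (L : Set E)) ‹_› h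
  refine ⟨this, ⟨?_⟩⟩
  rw [eq_top_iff, ← IsZLattice.span_top (K := ℝ) (L := L), Submodule.span_le]
  intro x hx
  have := Submodule.smul_mem _ (k : ℝ)⁻¹ (Submodule.subset_span (R := ℝ) (hM x hx))
  rwa [← Int.cast_smul_eq_zsmul ℝ, inv_smul_smul₀ (by exact_mod_cast hk)] at this

variable [FiniteDimensional ℝ E] [MeasurableSpace E] [BorelSpace E]

theorem exists_isAddFundamentalDomain (L : Submodule ℤ E) [DiscreteTopology L] [IsZLattice ℝ L] :
    ∃ F : Set E, IsAddFundamentalDomain L F (volume : Measure E) ∧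
      (volume : Measure E).real F = ZLattice.covolume L (volume : Measure E) ∧
      (volume : Measure E) F ≠ ⊤ := by
  have := ZLattice.module_free ℝ L
  have := ZLattice.module_finite ℝ L
  have hF := ZLattice.isAddFundamentalDomain (Free.chooseBasis ℤ L) (volume : Measure E)
  exact ⟨_, hF, (ZLattice.covolume_eq_measure_fundamentalDomain L volume hF).symm,
    (ZSpan.fundamentalDomain_isBounded _).measure_lt_top.ne⟩

/-- The volume of the ball is the integral over `F` of the number of translates of `x` by `L` that
fall in it. If `y` in `L` is within `ρ` of `x`, the translates `s + (x - y)` with `s ∈ S` all do.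
The fundamental domain `F` may thus be arbitrary. -/
theorem card_mul_covolume_le (L : Submodule ℤ E) [DiscreteTopology L] [IsZLattice ℝ L]
    {r ρ : ℝ} (hρ : ∀ y, ∃ x ∈ L, ‖y - x‖ ≤ ρ) (S : Finset L) (hS : ∀ x ∈ S, ‖(x : E)‖ ≤ r) :
    S.card * ZLattice.covolume L (volume : Measure E) ≤
      (volume : Measure E).real (Metric.closedBall 0 (r + ρ)) := by
  classical
  obtain ⟨F, hF, hFV, -⟩ := exists_isAddFundamentalDomain L
  have hmeas : MeasurableSet (Metric.closedBall (0 : E) (r + ρ)) :=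
    Metric.isClosed_closedBall.measurableSet
  rw [← hFV]
  have : VAddInvariantMeasure L E (volume : Measure E) :=
    inferInstanceAs (VAddInvariantMeasure L.toAddSubgroup E volume)
  have key : (S.card : ENNReal) * volume F ≤
      volume (Metric.closedBall (0 : E) (r + ρ)) := by
    rw [← lintegral_indicator_one hmeas, hF.lintegral_eq_tsum'', ← lintegral_tsum,
      ← setLIntegral_const]
    · refine lintegral_mono fun x => ?_
      obtain ⟨y, hy, hxy⟩ := hρ x
      have : (S.card : ENNReal) = ∑ g ∈ S.map (Equiv.subRight (⟨y, hy⟩ : L)).toEmbedding, 1 := by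
        simp
      rw [this]
      refine le_trans (Finset.sum_le_sum fun g hg => ?_) (ENNReal.sum_le_tsum _)
      obtain ⟨s, hs, rfl⟩ := Finset.mem_map.1 hg
      rw [Set.indicator_of_mem]
      · rfl
      rw [mem_closedBall_zero_iff]
      have : (s - ⟨y, hy⟩ : L) +ᵥ x = (s : E) + (x - y) := by
        simp [Submodule.vadd_def]; abel
      simp only [Equiv.coe_toEmbedding, Equiv.subRight_apply, this]
      exact (norm_add_le _ _).trans (add_le_add (hS s hs) hxy)
    · intro g
      exact ((measurable_one.indicator hmeas).comp (measurable_const_vadd g)).aemeasurable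
  have := ENNReal.toReal_mono measure_closedBall_lt_top.ne key
  simpa [Measure.real] using this

theorem volume_ball_le_covolume (L : Submodule ℤ E) [DiscreteTopology L] [IsZLattice ℝ L]
    {r : ℝ} (hr : ∀ x ∈ L, x ≠ 0 → r ≤ ‖x‖) :
    (volume : Measure E).real (Metric.ball 0 r) ≤
      ZLattice.covolume L (volume : Measure E) * 2 ^ finrank ℝ E := by
  obtain ⟨F, hF, hFV, hFt⟩ := exists_isAddFundamentalDomain L
  by_contra! hcon
  rw [← hFV] at hcon
  have h : volume F * 2 ^ finrank ℝ E < volume (Metric.ball (0 : E) r) := by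
    rw [← ENNReal.toReal_lt_toReal (ENNReal.mul_ne_top hFt (by simp)) measure_ball_lt_top.ne]
    simpa [Measure.real] using hcon
  have : Countable L.toAddSubgroup := inferInstanceAs (Countable L)
  obtain ⟨x, hx0, hx⟩ := exists_ne_zero_mem_lattice_of_measure_mul_two_pow_lt_measure
    (L := L.toAddSubgroup) hF (fun x hx => by simpa using hx) (convex_ball 0 r) h
  exact (hr x x.2 (by simpa using hx0)).not_gt (mem_ball_zero_iff.1 hx)

end Euclidean

/-! ### Lines in the plane over a finite field -/

section Lines

variable {F : Type*} [CommRing F]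

/-- These are the points of the projective line. `IsField` keeps the given ring structure, as needed
for a quotient of `𝓞 K`. -/
theorem ncard_lines [Finite F] (hF : IsField F) :
    {C : Submodule F (Fin 2 → F) | finrank F C = 1}.ncard = Nat.card F + 1 := by
  let _ := hF.toField
  rw [← Projectivization.card_of_finrank_two (k := F) (V := Fin 2 → F) (by simp),
    Nat.card_congr (Projectivization.equivSubmodule F (Fin 2 → F))]
  rfl

theorem line_eq_of_mem (hF : IsField F) {C D : Submodule F (Fin 2 → F)} (hC : finrank F C = 1)
    (hD : finrank F D = 1) {v : Fin 2 → F} (hv : v ≠ 0) (hvC : v ∈ C) (hvD : v ∈ D) : C = D := by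
  let _ := hF.toField
  have : ∀ C : Submodule F (Fin 2 → F), finrank F C = 1 → v ∈ C → Submodule.span F {v} = C := by
    intro C hC hvC
    have hle : Submodule.span F {v} ≤ C := by simpa using hvC
    refine Submodule.eq_of_le_of_finrank_eq hle ?_
    exact (finrank_span_singleton hv).trans hC.symm
  rw [← this C hC hvC, this D hD hvD]

theorem index_line [Finite F] (hF : IsField F) {C : Submodule F (Fin 2 → F)} (hC : finrank F C = 1) :
    C.toAddSubgroup.index = Nat.card F := by
  let _ := hF.toField
  have h1 : Nat.card C = Nat.card F := by
    have := Module.natCard_eq_pow_finrank (K := F) (V := C)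
    rwa [hC, pow_one] at this
  have h2 := C.toAddSubgroup.card_mul_index
  have h3 : Nat.card (Fin 2 → F) = Nat.card F * Nat.card F := by
    rw [Nat.card_fun, Nat.card_fin, sq]
  have h4 : Nat.card C.toAddSubgroup = Nat.card F := h1
  rw [h3, h4] at h2
  exact Nat.eq_of_mul_eq_mul_left Nat.card_pos h2

end Lines

/-! ### The Euclidean space `K ⊗ ℝ` and the lattice `Λ₀` -/

section Embeddings

variable (K : Type*) [Field K] [NumberField K]

/-- The inclusion of `K ⊗ ℝ` into the Hermitian space indexed by the complex embeddings. -/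
def euclideanKIncl : EuclideanK K →ₗᵢ[ℝ] PiLp 2 (fun _ : K →+* ℂ => ℂ) :=
  (Submodule.span ℝ (Set.range (hermitianEmbedding K))).subtypeₗᵢ

@[simp]
theorem euclideanKIncl_embK (x : K) : euclideanKIncl K (embK K x) = hermitianEmbedding K x := rfl

theorem norm_embK_sq (x : K) : ‖embK K x‖ ^ 2 = ∑ σ : K →+* ℂ, ‖σ x‖ ^ 2 := by
  rw [← (euclideanKIncl K).norm_map, euclideanKIncl_embK, PiLp.norm_sq_eq_of_L2]
  rfl

theorem norm_embIntegers_sq (s : ℕ) (x : Fin s → 𝓞 K) :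
    ‖embIntegers K s x‖ ^ 2 = ∑ i, ‖embK K (x i : K)‖ ^ 2 := by
  rw [PiLp.norm_sq_eq_of_L2]
  rfl

theorem embK_injective : Function.Injective (embK K) := by
  refine (injective_iff_map_eq_zero _).2 fun x hx => ?_
  have h := norm_embK_sq K x
  rw [hx, norm_zero, zero_pow two_ne_zero, eq_comm,
    Finset.sum_eq_zero_iff_of_nonneg fun _ _ => by positivity] at h
  obtain ⟨σ⟩ := (inferInstance : Nonempty (K →+* ℂ))
  simpa using h σ (Finset.mem_univ _)

theorem embIntegers_injective (s : ℕ) : Function.Injective (embIntegers K s) := by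
  intro x y h
  ext i
  exact embK_injective K (congrArg (fun z : Ambient K s => z i) h)

variable {K} in
-- Used for an integral basis, to see that `Λ₀` is a lattice, and for the powers of `ζ`, to bound
-- its covering radius.
theorem span_range_embK {ι : Type*} {v : ι → K} (hv : Submodule.span ℚ (Set.range v) = ⊤) :
    Submodule.span ℝ (Set.range fun i => embK K (v i)) = ⊤ := by
  set N := Submodule.span ℝ (Set.range fun i => embK K (v i))
  have h1 : ∀ x : K, embK K x ∈ N := by
    intro x
    have hx : x ∈ Submodule.span ℚ (Set.range v) := hv ▸ Submodule.mem_top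
    induction hx using Submodule.span_induction with
    | mem x hx =>
      obtain ⟨i, rfl⟩ := hx
      exact Submodule.subset_span ⟨i, rfl⟩
    | zero => rw [map_zero]; exact N.zero_mem
    | add x y _ _ hx hy => rw [map_add]; exact N.add_mem hx hy
    | smul a x _ hx =>
      have : embK K (a • x) = (a : ℝ) • embK K x := by
        apply (euclideanKIncl K).injective
        rw [LinearIsometry.map_smul, euclideanKIncl_embK, euclideanKIncl_embK]
        ext σ : 1
        simp [hermitianEmbedding, Algebra.smul_def]
      rw [this]
      exact N.smul_mem _ hx
  have h2 : Submodule.span ℝ (Set.range (hermitianEmbedding K)) ≤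
      N.map (euclideanKIncl K).toLinearMap := by
    rw [Submodule.span_le]
    rintro _ ⟨x, rfl⟩
    exact ⟨embK K x, h1 x, rfl⟩
  rw [eq_top_iff]
  intro y _
  obtain ⟨z, hz, hzy⟩ := h2 (show euclideanKIncl K y ∈ _ from Subtype.property
    (p := fun t => t ∈ Submodule.span ℝ (Set.range (hermitianEmbedding K))) y)
  rwa [← (euclideanKIncl K).injective hzy]

theorem linearIndependent_embK_integralBasis :
    LinearIndependent ℝ fun i => embK K (integralBasis K i) := by
  have h := ((canonicalEmbedding.latticeBasis K).linearIndependent.restrict_scalars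
    (R := ℝ) (by
      intro a b h
      simpa using h))
  refine LinearIndependent.of_comp
    ((WithLp.linearEquiv 2 ℝ _).toLinearMap ∘ₗ (euclideanKIncl K).toLinearMap) ?_
  have he : ((WithLp.linearEquiv 2 ℝ _).toLinearMap ∘ₗ (euclideanKIncl K).toLinearMap) ∘
      (fun i => embK K (integralBasis K i)) = canonicalEmbedding.latticeBasis K := by
    ext i : 1
    rw [canonicalEmbedding.latticeBasis_apply]
    rfl
  rw [he]
  exact h

/-- The real basis of `K ⊗ ℝ` formed by an integral basis of `K`. -/
def euclideanKBasis : Basis (Free.ChooseBasisIndex ℤ (𝓞 K)) ℝ (EuclideanK K) :=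
  Basis.mk (linearIndependent_embK_integralBasis K)
    (span_range_embK (integralBasis K).span_eq).ge

theorem finrank_ambient (s : ℕ) : finrank ℝ (Ambient K s) = s * finrank ℚ K := by
  rw [(WithLp.linearEquiv 2 ℝ (Fin s → EuclideanK K)).finrank_eq, Module.finrank_pi_fintype,
    finrank_eq_card_basis (euclideanKBasis K), finrank_eq_card_basis (integralBasis K)]
  simp

/-- The lattice `Λ₀`, image of `(𝓞 K) ^ s`. -/
def intLattice (s : ℕ) : Submodule ℤ (Ambient K s) :=
  AddSubgroup.toIntSubmodule (embIntegers K s).range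

variable {K} in
theorem mem_intLattice {s : ℕ} {x : Ambient K s} :
    x ∈ intLattice K s ↔ ∃ y, embIntegers K s y = x := Iff.rfl

/-- The vectors of `(K ⊗ ℝ) ^ s` with a single nonzero coordinate, taken from the family `v`. -/
def singleFamily {ι : Type*} (s : ℕ) (v : ι → 𝓞 K) (j : Fin s × ι) : Ambient K s :=
  embIntegers K s (Pi.single j.1 (v j.2))

variable {K} in
theorem embIntegers_single {s : ℕ} (i : Fin s) (a : 𝓞 K) :
    embIntegers K s (Pi.single i a) = PiLp.single 2 i (embK K a) := by
  ext j : 1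
  by_cases h : j = i
  · subst h; simp [embIntegers]
  · simp [embIntegers, h]

variable {K} in
theorem span_singleFamily {ι : Type*} (s : ℕ) {v : ι → 𝓞 K}
    (hv : Submodule.span ℚ (Set.range fun i => (v i : K)) = ⊤) :
    Submodule.span ℝ (Set.range (singleFamily K s v)) = ⊤ := by
  rw [eq_top_iff]
  intro y _
  have hy : y = ∑ i, PiLp.single 2 i (y i) := by
    ext j : 1
    simp
  rw [hy]
  refine Submodule.sum_mem _ fun i _ => ?_
  let f : EuclideanK K →ₗ[ℝ] Ambient K s :=
    (WithLp.linearEquiv 2 ℝ (Fin s → EuclideanK K)).symm.toLinearMap ∘ₗ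
      LinearMap.single ℝ (fun _ => EuclideanK K) i
  have hf : ∀ a, f a = PiLp.single 2 i a := fun a => rfl
  have : (⊤ : Submodule ℝ (EuclideanK K)) ≤
      (Submodule.span ℝ (Set.range (singleFamily K s v))).comap f := by
    rw [← span_range_embK hv, Submodule.span_le]
    rintro _ ⟨k, rfl⟩
    refine Submodule.subset_span ⟨(i, k), ?_⟩
    rw [hf, ← embIntegers_single]
    rfl
  exact this (Submodule.mem_top (x := y i))

theorem intLattice_eq_span (s : ℕ) :
    intLattice K s =
      Submodule.span ℤ (Set.range (singleFamily K s (Free.chooseBasis ℤ (𝓞 K)))) := by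
  have h1 : intLattice K s =
      (⊤ : Submodule ℤ (Fin s → 𝓞 K)).map (embIntegers K s).toIntLinearMap := by
    ext x
    simp only [mem_intLattice, Submodule.mem_map, Submodule.mem_top, true_and]
    rfl
  have h2 := (Pi.basis fun _ : Fin s => Free.chooseBasis ℤ (𝓞 K)).span_eq
  rw [h1, ← h2, Submodule.map_span, ← Set.range_comp]
  congr 1
  ext x
  simp only [Set.mem_range, Function.comp_apply, Pi.basis_apply, Sigma.exists, Prod.exists]
  rfl

theorem isLattice_intLattice (s : ℕ) : IsLattice (intLattice K s) := by
  set v := singleFamily K s (Free.chooseBasis ℤ (𝓞 K)) with hv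
  have hspan : Submodule.span ℝ (Set.range v) = ⊤ := by
    refine span_singleFamily s ?_
    rw [← (integralBasis K).span_eq]
    congr 2
    ext i
    rw [integralBasis_apply]
    rfl
  have hli : LinearIndependent ℝ v := by
    refine linearIndependent_of_top_le_span_of_card_eq_finrank hspan.ge ?_
    rw [finrank_ambient, finrank_eq_card_basis (integralBasis K)]
    simp
  have := intLattice_eq_span K s
  rw [show Set.range (singleFamily K s (Free.chooseBasis ℤ (𝓞 K))) =
    Set.range (Basis.mk hli hspan.ge) by rw [Basis.coe_mk]] at this
  rw [this]
  exact ⟨inferInstance, inferInstance⟩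

end Embeddings

/-! ### Norm inequalities and multiplication by roots of unity -/

section Norms

variable {K : Type*} [Field K] [NumberField K]

/-- The norm of `x` is a nonzero multiple of that of `I`, and its square is the product of the `‖σ
x‖ ^ 2`, whose arithmetic mean is `‖x‖ ^ 2 / n`. -/
theorem absNorm_sq_le_norm_embK_pow {I : Ideal (𝓞 K)} {x : 𝓞 K} (hx : x ∈ I) (hx0 : x ≠ 0) :
    (finrank ℚ K : ℝ) ^ finrank ℚ K * (Ideal.absNorm I : ℝ) ^ 2 ≤
      (‖embK K (x : K)‖ ^ 2) ^ finrank ℚ K := by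
  have hn : 0 < finrank ℚ K := finrank_pos
  have h1 : (Ideal.absNorm I : ℝ) ≤ |(Algebra.norm ℚ (x : K) : ℝ)| := by
    have hd : Ideal.absNorm I ∣ Ideal.absNorm (Ideal.span {x}) :=
      Ideal.absNorm_dvd_absNorm_of_le ((Ideal.span_singleton_le_iff_mem I).2 hx)
    rw [Ideal.absNorm_span_singleton] at hd
    have hle := Nat.le_of_dvd (Int.natAbs_pos.2 (Algebra.norm_ne_zero_iff.2 hx0)) hd
    have h2 : Algebra.norm ℚ (x : K) = (Algebra.norm ℤ x : ℚ) :=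
      (Algebra.coe_norm_int x).symm
    rw [h2]
    have : ((Algebra.norm ℤ x).natAbs : ℝ) = |((Algebra.norm ℤ x : ℚ) : ℝ)| := by
      rw [Nat.cast_natAbs]; push_cast; rfl
    rw [← this]
    exact_mod_cast hle
  have h2 : ∏ σ : K →+* ℂ, ‖σ (x : K)‖ = |(Algebra.norm ℚ (x : K) : ℝ)| := by
    have := Algebra.norm_eq_prod_embeddings ℚ ℂ (x : K)
    have h3 := congrArg norm this
    rw [norm_prod] at h3
    rw [← Fintype.prod_equiv (RingHom.equivRatAlgHom K ℂ).symm (fun σ => ‖σ (x : K)‖)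
      (fun σ => ‖σ (x : K)‖) (fun _ => rfl), ← h3]
    simp
  have h3 : (∏ σ : K →+* ℂ, ‖σ (x : K)‖ ^ 2) ≤
      ((∑ σ : K →+* ℂ, ‖σ (x : K)‖ ^ 2) / finrank ℚ K) ^ finrank ℚ K := by
    have h := Real.geom_mean_le_arith_mean (Finset.univ : Finset (K →+* ℂ)) (fun _ => 1)
      (fun σ => ‖σ (x : K)‖ ^ 2) (fun _ _ => zero_le_one)
      (by simp [Embeddings.card, hn]) (fun _ _ => by positivity)
    simp only [Real.rpow_one, one_mul, Finset.sum_const, Finset.card_univ, Embeddings.card,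
      nsmul_eq_mul, mul_one] at h
    rw [← Real.rpow_inv_natCast_pow
      (Finset.prod_nonneg fun (σ : K →+* ℂ) _ => sq_nonneg ‖σ (x : K)‖) hn.ne']
    gcongr
  rw [← norm_embK_sq, Finset.prod_pow, h2, div_pow, le_div_iff₀ (by positivity)] at h3
  refine le_trans ?_ h3
  rw [mul_comm]
  gcongr

theorem norm_embK_mul_of_norm_eq_one {ζ : K} (hζ : ∀ σ : K →+* ℂ, ‖σ ζ‖ = 1) (x : K) :
    ‖embK K (ζ * x)‖ = ‖embK K x‖ := by
  rw [← sq_eq_sq₀ (norm_nonneg _) (norm_nonneg _), norm_embK_sq, norm_embK_sq]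
  simp [hζ]

theorem norm_embIntegers_smul_of_norm_eq_one {ζ : 𝓞 K} (hζ : ∀ σ : K →+* ℂ, ‖σ ζ‖ = 1) {s : ℕ}
    (x : Fin s → 𝓞 K) : ‖embIntegers K s (ζ • x)‖ = ‖embIntegers K s x‖ := by
  rw [← sq_eq_sq₀ (norm_nonneg _) (norm_nonneg _), norm_embIntegers_sq, norm_embIntegers_sq]
  simp [norm_embK_mul_of_norm_eq_one hζ]

/-- A nonzero vector with coordinates in an ideal is long, by the inequality between the
arithmetic and the geometric mean. -/
theorem absNorm_sq_le_norm_embIntegers_pow {I : Ideal (𝓞 K)} {s : ℕ} {x : Fin s → 𝓞 K}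
    (hx : ∀ i, x i ∈ I) (hx0 : x ≠ 0) :
    (finrank ℚ K : ℝ) ^ finrank ℚ K * (Ideal.absNorm I : ℝ) ^ 2 ≤
      (‖embIntegers K s x‖ ^ 2) ^ finrank ℚ K := by
  obtain ⟨i, hi⟩ := Function.ne_iff.1 hx0
  refine (absNorm_sq_le_norm_embK_pow (hx i) hi).trans ?_
  rw [norm_embIntegers_sq]
  gcongr
  exact Finset.single_le_sum (f := fun i => ‖embK K (x i : K)‖ ^ 2) (fun _ _ => by positivity)
    (Finset.mem_univ i)

end Norms

/-! ### Choice of the radius -/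

section Radius

/-- The three conclusions serve, in order, to give the density, to keep short vectors out of `𝔓 ^
2`, and to absorb the covering radius `n`. -/
theorem exists_radius {n : ℕ} {m q V B ε η : ℝ} (hn : 1 ≤ n) (hm : 2 ≤ m) (hnm : (n : ℝ) ≤ m)
    (hq0 : 0 < q) (hV : 0 < V) (hB : 0 < B) (hε₀ : 0 < ε) (hε₁ : ε < 1) (hη₀ : 0 < η) (hη₁ : η ≤ 1)
    (hη : Real.exp η ≤ 1 / (1 - ε / 2)) (hVl : B * (n : ℝ) ^ n ≤ V * 4 ^ n)
    (hVu : V ≤ B * (n : ℝ) ^ (2 * n))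
    (hq : (n : ℝ) ^ 2 * m ≤ (η / 8) ^ 2 * q ^ (1 / (n : ℝ))) :
    ∃ r : ℝ, 0 < r ∧ B * r ^ (2 * n) = (1 - ε / 2) * m * q * V ∧
      (r ^ 2) ^ n < (n : ℝ) ^ n * q ^ 2 ∧ B * (r + n) ^ (2 * n) ≤ m * q * V := by
  have hn1 : (1 : ℝ) ≤ n := by exact_mod_cast hn
  have h2n : 2 * n ≠ 0 := by omega
  have hε2 : 0 < 1 - ε / 2 := by linarith
  have hqn : ((n : ℝ) ^ 2 * m / (η / 8) ^ 2) ^ n ≤ q := by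
    have h1 : (n : ℝ) ^ 2 * m / (η / 8) ^ 2 ≤ q ^ (1 / (n : ℝ)) := by
      rw [div_le_iff₀ (by positivity)]
      linarith
    calc _ ≤ (q ^ (1 / (n : ℝ))) ^ n := by gcongr
      _ = q := by rw [one_div, Real.rpow_inv_natCast_pow hq0.le (by omega)]
  set A := (1 - ε / 2) * m * q * V / B with hA
  have hA0 : 0 < A := by positivity
  set r := A ^ (((2 * n : ℕ) : ℝ)⁻¹) with hr
  have hr0 : 0 < r := Real.rpow_pos_of_pos hA0 _
  have hrA : r ^ (2 * n) = A := Real.rpow_inv_natCast_pow hA0.le h2n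
  have hBr : B * r ^ (2 * n) = (1 - ε / 2) * m * q * V := by
    rw [hrA, hA]; field_simp
  refine ⟨r, hr0, hBr, ?_, ?_⟩
  · rw [← pow_mul, hrA, hA, div_lt_iff₀ hB]
    have h1 : m * (n : ℝ) ^ n < q := by
      calc m * (n : ℝ) ^ n ≤ m ^ n * (n : ℝ) ^ n := by
            gcongr
            exact le_self_pow₀ (by linarith) (by omega)
        _ = (n * m) ^ n := by rw [mul_pow]; ring
        _ < ((n : ℝ) ^ 2 * m / (η / 8) ^ 2) ^ n := by
            refine pow_lt_pow_left₀ ?_ (by positivity) (by omega)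
            rw [lt_div_iff₀ (by positivity)]
            have : (η / 8) ^ 2 < 1 := by nlinarith
            have h3 : (n : ℝ) * m ≤ (n : ℝ) ^ 2 * m := by
              gcongr
              nlinarith
            have h4 : 0 < (n : ℝ) * m := by positivity
            nlinarith
        _ ≤ q := hqn
    calc (1 - ε / 2) * m * q * V ≤ 1 * m * q * (B * (n : ℝ) ^ (2 * n)) := by
          gcongr
          linarith
      _ = (m * (n : ℝ) ^ n) * ((n : ℝ) ^ n * q * B) := by ring
      _ < q * ((n : ℝ) ^ n * q * B) := by gcongr
      _ = (n : ℝ) ^ n * q ^ 2 * B := by ring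
  -- The lower bound on `V` contributes `(n/4)^n`; with `n ≤ m`, the constant `η/8` yields `r ≥
  -- 4n²/η`, twice what is needed below.
  · have h1 : ((4 * (n : ℝ) ^ 2 / η) ^ 2) ^ n ≤ r ^ (2 * n) := by
      rw [hrA, hA, le_div_iff₀ hB]
      have h3 : (4 * (n : ℝ) ^ 2 / η) ^ 2 ≤ (n : ℝ) ^ 2 * m / (η / 8) ^ 2 * (n / 4) := by
        have : (4 * (n : ℝ) ^ 2 / η) ^ 2 = (n : ℝ) ^ 2 * n / (η / 8) ^ 2 * (n / 4) := by
          field_simp; norm_num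
        rw [this]
        gcongr
      calc ((4 * (n : ℝ) ^ 2 / η) ^ 2) ^ n * B
          ≤ ((n : ℝ) ^ 2 * m / (η / 8) ^ 2 * (n / 4)) ^ n * B := by gcongr
        _ = ((n : ℝ) ^ 2 * m / (η / 8) ^ 2) ^ n * (B * (n : ℝ) ^ n / 4 ^ n) := by
            rw [mul_pow, div_pow (n : ℝ) 4]; ring
        _ ≤ q * V := by
            gcongr
            rwa [div_le_iff₀ (by positivity)]
        _ = 1 * (q * V) := by ring
        -- Here `m ≥ 2` and `ε < 1` give `(1 - ε/2) m ≥ 1`.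
        _ ≤ ((1 - ε / 2) * m) * (q * V) := by
            gcongr
            nlinarith
        _ = _ := by ring
    have h2 : 4 * (n : ℝ) ^ 2 / η ≤ r := by
      rw [← pow_mul] at h1
      exact (pow_le_pow_iff_left₀ (by positivity) hr0.le h2n).1 h1
    have h3 : (n / r + 1) ^ (2 * n) ≤ 1 / (1 - ε / 2) := by
      calc (n / r + 1) ^ (2 * n) ≤ Real.exp (n / r) ^ (2 * n) := by
            gcongr
            exact Real.add_one_le_exp _
        _ = Real.exp (2 * (n : ℝ) ^ 2 / r) := by
            rw [← Real.exp_nat_mul]; congr 1; push_cast; ring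
        _ ≤ Real.exp η := by
            gcongr
            rw [div_le_iff₀ hr0]
            rw [div_le_iff₀ hη₀] at h2
            nlinarith
        _ ≤ _ := hη
    have h4 : r + n = r * (n / r + 1) := by field_simp; ring
    calc B * (r + n) ^ (2 * n) = (1 - ε / 2) * m * q * V * (n / r + 1) ^ (2 * n) := by
          rw [h4, mul_pow, ← mul_assoc, hBr]
      _ ≤ (1 - ε / 2) * m * q * V * (1 / (1 - ε / 2)) := by gcongr
      _ = m * q * V := by 
          rw [mul_one_div, div_eq_iff hε2.ne']; ring

end Radius

/-! ### Construction A and the counting argument -/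

section ConstructionA

variable {K : Type*} [Field K] {𝔓 : Ideal (𝓞 K)}

theorem reduction_surjective (s : ℕ) : Function.Surjective (reduction 𝔓 s) := fun y =>
  ⟨fun i => (Ideal.Quotient.mk_surjective (y i)).choose,
    funext fun i => (Ideal.Quotient.mk_surjective (y i)).choose_spec⟩

theorem reduction_smul (s : ℕ) (a : 𝓞 K) (y : Fin s → 𝓞 K) :
    reduction 𝔓 s (a • y) = Ideal.Quotient.mk 𝔓 a • reduction 𝔓 s y := by
  ext i
  simp [reduction]

theorem reduction_eq_zero {s : ℕ} {y : Fin s → 𝓞 K} :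
    reduction 𝔓 s y = 0 ↔ ∀ i, y i ∈ 𝔓 := by
  simp [funext_iff, reduction, Ideal.Quotient.eq_zero_iff_mem]

variable [NumberField K]

theorem mem_codeLattice {s : ℕ} {C : Submodule (𝓞 K ⧸ 𝔓) (Fin s → 𝓞 K ⧸ 𝔓)} {x : Ambient K s} :
    x ∈ codeLattice 𝔓 C ↔ ∃ y, reduction 𝔓 s y ∈ C ∧ embIntegers K s y = x := Iff.rfl

theorem codeLattice_le {s : ℕ} (C : Submodule (𝓞 K ⧸ 𝔓) (Fin s → 𝓞 K ⧸ 𝔓)) :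
    codeLattice 𝔓 C ≤ intLattice K s := fun _ ⟨y, _, hy⟩ => ⟨y, hy⟩

theorem codeLattice_injective (s : ℕ) : Function.Injective
    (codeLattice 𝔓 : Submodule (𝓞 K ⧸ 𝔓) (Fin s → 𝓞 K ⧸ 𝔓) → Submodule ℤ (Ambient K s)) := by
  have : ∀ C D : Submodule (𝓞 K ⧸ 𝔓) (Fin s → 𝓞 K ⧸ 𝔓),
      codeLattice 𝔓 C = codeLattice 𝔓 D → C ≤ D := by
    intro C D h x hx
    obtain ⟨y, rfl⟩ := reduction_surjective s x
    obtain ⟨z, hz, hzy⟩ := mem_codeLattice.1 (h ▸ mem_codeLattice.2 ⟨y, hx, rfl⟩)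
    rwa [← embIntegers_injective K s hzy]
  exact fun C D h => le_antisymm (this C D h) (this D C h.symm)

/-- The norm of `𝔓` lies in `𝔓`, so that multiple of `Λ₀` reduces to zero and is contained in the
lattice of every code. -/
theorem isLattice_codeLattice (h𝔓 : 𝔓 ≠ ⊥) {s : ℕ}
    (C : Submodule (𝓞 K ⧸ 𝔓) (Fin s → 𝓞 K ⧸ 𝔓)) : IsLattice (codeLattice 𝔓 C) := by
  obtain ⟨_, _⟩ := isLattice_intLattice K s
  refine isLattice_of_smul_mem (intLattice K s) _ (codeLattice_le C) (k := Ideal.absNorm 𝔓)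
    (by simpa [Ideal.absNorm_eq_zero_iff] using h𝔓) ?_
  rintro _ ⟨y, rfl⟩
  refine mem_codeLattice.2 ⟨(Ideal.absNorm 𝔓 : ℤ) • y, ?_, map_zsmul _ _ _⟩
  rw [reduction_eq_zero.2]
  · exact C.zero_mem
  · intro i
    simpa using 𝔓.mul_mem_right (y i) (Ideal.absNorm_mem 𝔓)

theorem relIndex_codeLattice {s : ℕ} (C : Submodule (𝓞 K ⧸ 𝔓) (Fin s → 𝓞 K ⧸ 𝔓)) :
    (codeLattice 𝔓 C).toAddSubgroup.relIndex (intLattice K s).toAddSubgroup =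
      C.toAddSubgroup.index := by
  have h := AddSubgroup.relIndex_map_map_of_injective (C.toAddSubgroup.comap (reduction 𝔓 s)) ⊤
    (embIntegers_injective K s)
  rw [AddSubgroup.relIndex_top_right,
    AddSubgroup.index_comap_of_surjective _ (reduction_surjective s), ← AddMonoidHom.range_eq_map]
    at h
  exact h

theorem isField_quotient (hp : 𝔓.IsPrime) (h𝔓 : 𝔓 ≠ ⊥) : IsField (𝓞 K ⧸ 𝔓) :=
  (Ideal.Quotient.maximal_ideal_iff_isField_quotient 𝔓).1 (hp.isMaximal h𝔓)

theorem ncard_lineFamily (hp : 𝔓.IsPrime) (h𝔓 : 𝔓 ≠ ⊥) :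
    (lineFamily 𝔓).ncard = Ideal.absNorm 𝔓 + 1 := by
  have : Finite (𝓞 K ⧸ 𝔓) := Ideal.finiteQuotientOfFreeOfNeBot 𝔓 h𝔓
  have h : lineFamily 𝔓 = codeLattice 𝔓 ''
      {C : Submodule (𝓞 K ⧸ 𝔓) (Fin 2 → 𝓞 K ⧸ 𝔓) | finrank (𝓞 K ⧸ 𝔓) C = 1} := by
    ext Λ
    simp [lineFamily, eq_comm]
  rw [h, Set.ncard_image_of_injective _ (codeLattice_injective 2),
    ncard_lines (isField_quotient hp h𝔓)]
  rfl

theorem covolume_codeLattice_line (hp : 𝔓.IsPrime) (h𝔓 : 𝔓 ≠ ⊥)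
    {C : Submodule (𝓞 K ⧸ 𝔓) (Fin 2 → 𝓞 K ⧸ 𝔓)} (hC : finrank (𝓞 K ⧸ 𝔓) C = 1) :
    ZLattice.covolume (codeLattice 𝔓 C) (volume : Measure (Ambient K 2)) =
      Ideal.absNorm 𝔓 * ZLattice.covolume (intLattice K 2) (volume : Measure (Ambient K 2)) := by
  have : Finite (𝓞 K ⧸ 𝔓) := Ideal.finiteQuotientOfFreeOfNeBot 𝔓 h𝔓
  obtain ⟨_, _⟩ := isLattice_intLattice K 2
  obtain ⟨_, _⟩ := isLattice_codeLattice h𝔓 C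
  have h := ZLattice.covolume_div_covolume_eq_relIndex' _ _ (codeLattice_le C)
  rw [relIndex_codeLattice, index_line (isField_quotient hp h𝔓) hC,
    div_eq_iff (ZLattice.covolume_ne_zero _ _)] at h
  exact h

/-- If every line gives a lattice with a short nonzero vector, then translating these vectors by
units of absolute value `1` gives many short vectors of `Λ₀`. -/
theorem mul_card_mul_covolume_le (hp : 𝔓.IsPrime) (h𝔓 : 𝔓 ≠ ⊥) {m : ℕ} {u : Fin m → (𝓞 K)ˣ}
    (hu : Function.Injective u) (hu1 : ∀ i, ∀ σ : K →+* ℂ, ‖σ (u i : 𝓞 K)‖ = 1) {r ρ : ℝ}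
    (hρ : ∀ y, ∃ x ∈ intLattice K 2, ‖y - x‖ ≤ ρ)
    (hr : ∀ y : Fin 2 → 𝓞 K, (∀ i, y i ∈ 𝔓) → y ≠ 0 → r < ‖embIntegers K 2 y‖)
    (hC : ∀ C : Submodule (𝓞 K ⧸ 𝔓) (Fin 2 → 𝓞 K ⧸ 𝔓), finrank (𝓞 K ⧸ 𝔓) C = 1 →
      ∃ x ∈ codeLattice 𝔓 C, x ≠ 0 ∧ ‖x‖ ≤ r) :
    (Ideal.absNorm 𝔓 + 1 : ℝ) * m *
        ZLattice.covolume (intLattice K 2) (volume : Measure (Ambient K 2)) ≤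
      (volume : Measure (Ambient K 2)).real (Metric.closedBall 0 (r + ρ)) := by
  classical
  have : Finite (𝓞 K ⧸ 𝔓) := Ideal.finiteQuotientOfFreeOfNeBot 𝔓 h𝔓
  have hF := isField_quotient hp h𝔓
  obtain ⟨_, _⟩ := isLattice_intLattice K 2
  let T := {C : Submodule (𝓞 K ⧸ 𝔓) (Fin 2 → 𝓞 K ⧸ 𝔓) | finrank (𝓞 K ⧸ 𝔓) C = 1}
  have hT : Nat.card T = Ideal.absNorm 𝔓 + 1 := ncard_lines hF
  have : Fintype T := Fintype.ofFinite T
  have hy : ∀ C : T, ∃ y : Fin 2 → 𝓞 K, reduction 𝔓 2 y ∈ C.1 ∧ y ≠ 0 ∧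
      ‖embIntegers K 2 y‖ ≤ r := by
    intro C
    obtain ⟨_, ⟨y, hy, rfl⟩, h0, h1⟩ := hC C C.2
    exact ⟨y, hy, fun h => h0 (by rw [h, map_zero]), h1⟩
  choose y hyC hy0 hyr using hy
  let f : T × Fin m → intLattice K 2 := fun t =>
    ⟨embIntegers K 2 ((u t.2 : 𝓞 K) • y t.1), _, rfl⟩
  have hf : Function.Injective f := by
    rintro ⟨C, i⟩ ⟨D, j⟩ h
    have h1 : (u i : 𝓞 K) • y C = (u j : 𝓞 K) • y D :=
      embIntegers_injective K 2 (congrArg Subtype.val h)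
    -- A vector in `𝔓 ^ 2` would be longer than `r`, and the unit has not changed the norm.
    have hne : reduction 𝔓 2 ((u i : 𝓞 K) • y C) ≠ 0 := by
      intro h0
      have := hr _ (reduction_eq_zero.1 h0) (by simpa using hy0 C)
      rw [norm_embIntegers_smul_of_norm_eq_one (hu1 i)] at this
      exact this.not_ge (hyr C)
    -- Two distinct lines meet only in zero.
    have hCD : C = D := by
      refine Subtype.ext (line_eq_of_mem hF C.2 D.2 hne ?_ ?_)
      · rw [reduction_smul]; exact C.1.smul_mem _ (hyC C)
      · rw [h1, reduction_smul]; exact D.1.smul_mem _ (hyC D)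
    subst hCD
    obtain ⟨k, hk⟩ := Function.ne_iff.1 (hy0 C)
    have hij := mul_right_cancel₀ hk (congrFun h1 k)
    rw [hu (Units.ext hij)]
  have hcard := card_mul_covolume_le (intLattice K 2) hρ (Finset.univ.map ⟨f, hf⟩) (r := r) (by
    intro x hx
    obtain ⟨⟨C, i⟩, -, rfl⟩ := Finset.mem_map.1 hx
    exact (norm_embIntegers_smul_of_norm_eq_one (hu1 i) (y C)).le.trans (hyr C))
  rw [Finset.card_map, Finset.card_univ, Fintype.card_prod, Fintype.card_fin,
    ← Nat.card_eq_fintype_card, hT] at hcard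
  exact_mod_cast hcard

theorem lt_norm_embIntegers_of_mem {r : ℝ} (hr : (r ^ 2) ^ finrank ℚ K <
      (finrank ℚ K : ℝ) ^ finrank ℚ K * (Ideal.absNorm 𝔓 : ℝ) ^ 2) {s : ℕ} {y : Fin s → 𝓞 K}
    (hy : ∀ i, y i ∈ 𝔓) (hy0 : y ≠ 0) : r < ‖embIntegers K s y‖ := by
  have h := lt_of_pow_lt_pow_left₀ _ (sq_nonneg _)
    (hr.trans_le (absNorm_sq_le_norm_embIntegers_pow hy hy0))
  exact lt_of_pow_lt_pow_left₀ 2 (norm_nonneg _) h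

end ConstructionA

theorem volume_real_closedBall_eq {E : Type*} [NormedAddCommGroup E] [InnerProductSpace ℝ E]
    [FiniteDimensional ℝ E] [MeasurableSpace E] [BorelSpace E] {r : ℝ} (hr : 0 ≤ r) :
    (volume : Measure E).real (Metric.closedBall 0 r) =
      (volume : Measure E).real (Metric.ball 0 1) * r ^ finrank ℝ E := by
  rw [Measure.addHaar_real_closedBall _ _ hr, mul_comm]

theorem le_density {E : Type*} [NormedAddCommGroup E] [InnerProductSpace ℝ E]
    [FiniteDimensional ℝ E] [MeasurableSpace E] [BorelSpace E] [Nontrivial E] {Λ : Submodule ℤ E}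
    (hΛ : IsLattice Λ) {r : ℝ} (hr : ∀ x ∈ Λ, x ≠ 0 → r ≤ ‖x‖) :
    (volume : Measure E).real (Metric.closedBall 0 r) /
      (2 ^ finrank ℝ E * ZLattice.covolume Λ (volume : Measure E)) ≤ density Λ := by
  obtain ⟨_, _⟩ := hΛ
  -- Needed because `sInf ∅ = 0`: without nonzero vectors, the minimum would not be bounded below by
  -- `r`.
  have hne : {r : ℝ | ∃ x ∈ Λ, x ≠ 0 ∧ r = ‖x‖}.Nonempty := by
    by_contra hemp
    have h0 : ∀ x ∈ Λ, x = 0 := fun x hx => by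
      by_contra h
      exact hemp ⟨_, x, hx, h, rfl⟩
    have h1 : Submodule.span ℝ (Λ : Set E) = ⊥ := Submodule.span_eq_bot.2 h0
    rw [IsZLattice.span_top] at h1
    exact top_ne_bot h1
  have hmin : r ≤ minimum Λ := by
    refine le_csInf hne ?_
    rintro _ ⟨x, hx, hx0, rfl⟩
    exact hr x hx hx0
  have := ZLattice.covolume_pos Λ (volume : Measure E)
  rw [density]
  gcongr
  exact Metric.isBounded_closedBall.measure_lt_top.ne

/-! ### Cyclotomic fields: covering radius, roots of unity, density -/

section Cyclotomic

variable {m : ℕ} [NeZero m] {K : Type*} [Field K]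

theorem norm_embedding_eq_one {ζ : K} (hζ : IsPrimitiveRoot ζ m) (σ : K →+* ℂ) : ‖σ ζ‖ = 1 :=
  Complex.norm_eq_one_of_pow_eq_one (by rw [← map_pow, hζ.pow_eq_one, map_one]) (NeZero.ne m)

variable [NumberField K]

/-- The powers of `ζ` in each coordinate form `2n` vectors of squared norm `n`, so rounding leaves a
squared error of at most `2n²/4 ≤ n²`. -/
theorem exists_mem_intLattice_norm_sub_le [IsCyclotomicExtension {m} ℚ K] (y : Ambient K 2) :
    ∃ x ∈ intLattice K 2, ‖y - x‖ ≤ m.totient := by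
  have hζ := IsCyclotomicExtension.zeta_spec m ℚ K
  have hn := IsCyclotomicExtension.Rat.finrank m K
  set b := hζ.powerBasis ℚ with hb
  let v : Fin b.dim → 𝓞 K := fun i => hζ.toInteger ^ (i : ℕ)
  have hv : ∀ i, (v i : K) = b.basis i := by
    intro i
    simp only [PowerBasis.coe_basis, hb, IsPrimitiveRoot.powerBasis_gen]
    rfl
  have hspan : Submodule.span ℝ (Set.range (singleFamily K 2 v)) = ⊤ := by
    refine span_singleFamily 2 ?_
    simp only [hv]
    exact b.basis.span_eq
  have hnorm : ∀ j, ‖singleFamily K 2 v j‖ ^ 2 = m.totient := by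
    rintro ⟨i, k⟩
    rw [singleFamily, embIntegers_single, PiLp.norm_single, norm_embK_sq]
    have : ∀ σ : K →+* ℂ, ‖σ (v k : K)‖ = 1 := fun σ => by
      have h : (v k : K) = IsCyclotomicExtension.zeta m ℚ K ^ (k : ℕ) := rfl
      rw [h, map_pow, norm_pow, norm_embedding_eq_one hζ σ, one_pow]
    simp [this, Embeddings.card, hn]
  obtain ⟨x, hx, hxy⟩ := exists_mem_span_int_norm_sub_sq_le hspan y
  refine ⟨x, ?_, ?_⟩
  · refine Submodule.span_le.2 ?_ hx
    rintro _ ⟨j, rfl⟩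
    exact ⟨_, rfl⟩
  · refine le_of_sq_le_sq ?_ (Nat.cast_nonneg _)
    refine hxy.trans ?_
    simp only [hnorm, Finset.sum_const, Finset.card_univ, Fintype.card_prod, Fintype.card_fin,
      nsmul_eq_mul]
    rw [← b.finrank, hn]
    push_cast
    nlinarith [sq_nonneg (m.totient : ℝ)]

theorem exists_injective_units [IsCyclotomicExtension {m} ℚ K] :
    ∃ u : Fin m → (𝓞 K)ˣ, Function.Injective u ∧
      ∀ i, ∀ σ : K →+* ℂ, ‖σ (u i : 𝓞 K)‖ = 1 := by
  have hζ := IsCyclotomicExtension.zeta_spec m ℚ K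
  have hu := hζ.toInteger_isPrimitiveRoot
  refine ⟨fun i => (hu.isUnit (NeZero.ne m)).unit ^ (i : ℕ), ?_, ?_⟩
  · intro i j h
    have := congrArg Units.val h
    simp only [Units.val_pow_eq_pow_val, IsUnit.unit_spec] at this
    exact Fin.ext (hu.pow_inj i.2 j.2 this)
  · intro i σ
    have h : ‖σ (hζ.toInteger : K)‖ = 1 := norm_embedding_eq_one hζ σ
    simp [h]

theorem exists_line_density [IsCyclotomicExtension {m} ℚ K] {𝔓 : Ideal (𝓞 K)} (hp : 𝔓.IsPrime)
    (h𝔓 : 𝔓 ≠ ⊥) (hm : 2 ≤ m) {ε η : ℝ} (hε₀ : 0 < ε) (hε₁ : ε < 1) (hη₀ : 0 < η) (hη₁ : η ≤ 1)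
    (hη : Real.exp η ≤ 1 / (1 - ε / 2))
    (hq : (m.totient : ℝ) ^ 2 * m ≤
      (η / 8) ^ 2 * (Ideal.absNorm 𝔓 : ℝ) ^ (1 / (m.totient : ℝ))) :
    ∃ Λ ∈ lineFamily 𝔓, density Λ > (1 - ε) * (m : ℝ) / 2 ^ (2 * m.totient) := by
  have hn := IsCyclotomicExtension.Rat.finrank m K
  have hdim : finrank ℝ (Ambient K 2) = 2 * m.totient := by rw [finrank_ambient, hn]
  have hn0 : 0 < m.totient := Nat.totient_pos.2 (by omega)
  have : Nontrivial (Ambient K 2) := Module.nontrivial_of_finrank_pos (R := ℝ) (by omega)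
  obtain ⟨_, _⟩ := isLattice_intLattice K 2
  set n := m.totient
  set V := ZLattice.covolume (intLattice K 2) (volume : Measure (Ambient K 2)) with hVdef
  have hV : 0 < V := ZLattice.covolume_pos _ _
  set B := (volume : Measure (Ambient K 2)).real (Metric.ball 0 1)
  have hB : 0 < B := ENNReal.toReal_pos (Metric.measure_ball_pos _ _ one_pos).ne'
    measure_ball_lt_top.ne
  have hρ := exists_mem_intLattice_norm_sub_le (m := m) (K := K)
  have hq0 : (0 : ℝ) < Ideal.absNorm 𝔓 := by
    have : Ideal.absNorm 𝔓 ≠ 0 := mt Ideal.absNorm_eq_zero_iff.1 h𝔓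
    positivity
  -- With `I = ⊤` the norm inequality says that nonzero vectors of `Λ₀` have norm at least `√n`;
  -- then Minkowski applies.
  have hVl : B * (n : ℝ) ^ n ≤ V * 4 ^ n := by
    have h := volume_ball_le_covolume (intLattice K 2) (r := √n) (by
      rintro _ ⟨y, rfl⟩ hy0
      have h1 := absNorm_sq_le_norm_embIntegers_pow (I := ⊤) (x := y)
        (fun _ => Submodule.mem_top) (fun h => hy0 (by rw [h]; exact map_zero _))
      rw [Ideal.absNorm_top, hn, Nat.cast_one, one_pow, mul_one] at h1
      exact Real.sqrt_le_iff.2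
        ⟨norm_nonneg _, (pow_le_pow_iff_left₀ (by positivity) (by positivity) hn0.ne').1 h1⟩)
    rw [← Measure.addHaar_real_closedBall_eq_addHaar_real_ball,
      volume_real_closedBall_eq (Real.sqrt_nonneg _), hdim, pow_mul, pow_mul,
      Real.sq_sqrt (Nat.cast_nonneg _)] at h
    norm_num at h
    exact h
  -- Counting the origin alone: balls of radius `n` around `Λ₀` cover the space.
  have hVu : V ≤ B * (n : ℝ) ^ (2 * n) := by
    have h := card_mul_covolume_le (intLattice K 2) hρ {0} (r := 0) (by simp)
    rw [zero_add, volume_real_closedBall_eq (Nat.cast_nonneg _), hdim] at h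
    simpa using h
  obtain ⟨r, hr0, hBr, hrq, hrV⟩ := exists_radius (n := n) (m := m) hn0 (by exact_mod_cast hm)
    (by exact_mod_cast Nat.totient_le m) hq0 hV hB hε₀ hε₁ hη₀ hη₁ hη hVl hVu hq
  obtain ⟨u, hu, hu1⟩ := exists_injective_units (m := m) (K := K)
  have hC : ∃ C : Submodule (𝓞 K ⧸ 𝔓) (Fin 2 → 𝓞 K ⧸ 𝔓), finrank (𝓞 K ⧸ 𝔓) C = 1 ∧
      ∀ x ∈ codeLattice 𝔓 C, x ≠ 0 → r < ‖x‖ := by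
    by_contra! hcon
    have h := mul_card_mul_covolume_le hp h𝔓 hu hu1 hρ
      (fun y hy hy0 => lt_norm_embIntegers_of_mem (by rwa [hn]) hy hy0) hcon
    rw [volume_real_closedBall_eq (by positivity), hdim] at h
    have h2 := h.trans hrV
    have : 0 < (m : ℝ) * V := by
      have : (0 : ℝ) < m := by exact_mod_cast (show 0 < m by omega)
      positivity
    -- The count gives `(q + 1) m V ≤ m q V`, impossible since `m V > 0`.
    nlinarith
  obtain ⟨C, hC1, hCr⟩ := hC
  refine ⟨codeLattice 𝔓 C, ⟨C, hC1, rfl⟩, ?_⟩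
  refine lt_of_lt_of_le ?_ (le_density (isLattice_codeLattice h𝔓 C) fun x hx h0 => (hCr x hx h0).le)
  rw [volume_real_closedBall_eq hr0.le, hdim, hBr, covolume_codeLattice_line hp h𝔓 hC1, ← hVdef]
  have hm0 : (0 : ℝ) < m := by exact_mod_cast (show 0 < m by omega)
  have : (1 - ε / 2) * m * (Ideal.absNorm 𝔓 : ℝ) * V /
      (2 ^ (2 * n) * ((Ideal.absNorm 𝔓 : ℝ) * V)) = (1 - ε / 2) * m / 2 ^ (2 * n) := by
    rw [mul_assoc ((1 - ε / 2) * m), mul_div_mul_right _ _ (by positivity)]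
  rw [this]
  gcongr
  linarith

end Cyclotomic

end CyclotomicLattices
end

/-! ### The asymptotic statement -/

theorem mainTheorem2
    (p : ℕ → ℕ) (𝔓 : (m : ℕ) → Ideal (𝓞 (CyclotomicField m ℚ)))
    (hp : ∀ m : ℕ, 1 ≤ m → (p m).Prime)
    (hpm : ∀ m : ℕ, 1 ≤ m → ¬ p m ∣ m)
    (hprime : ∀ m : ℕ, 1 ≤ m → (𝔓 m).IsPrime)
    (hover : ∀ m : ℕ, 1 ≤ m → (𝔓 m).LiesOver (Ideal.span {(p m : ℤ)}))
    (hq : (fun m : ℕ => (Nat.totient m : ℝ) ^ 2 * (m : ℝ)) =o[atTop]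
      (fun m : ℕ => (Ideal.absNorm (𝔓 m) : ℝ) ^ (1 / (Nat.totient m : ℝ))))
    (ε : ℝ) (hε₀ : 0 < ε) (hε₁ : ε < 1) :
    ∀ᶠ m : ℕ in atTop,
      finrank ℝ (CyclotomicLattices.Ambient (CyclotomicField m ℚ) 2) = 2 * Nat.totient m ∧
      (CyclotomicLattices.lineFamily (𝔓 m)).ncard = Ideal.absNorm (𝔓 m) + 1 ∧
      (∀ Λ ∈ CyclotomicLattices.lineFamily (𝔓 m), CyclotomicLattices.IsLattice Λ) ∧
      ∃ Λ ∈ CyclotomicLattices.lineFamily (𝔓 m),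
        CyclotomicLattices.density Λ > (1 - ε) * (m : ℝ) / 2 ^ (2 * Nat.totient m) := by
  -- Chosen so that `exp δ = 1 / (1 - ε/2)`; the cap `η ≤ 1` keeps `(η/8)² < 1` in `exists_radius`.
  set δ := -Real.log (1 - ε / 2) with hδ
  have hδ0 : 0 < δ := by
    have := Real.log_neg (x := 1 - ε / 2) (by linarith) (by linarith)
    linarith
  set η := min δ 1 with hηdef
  have hη0 : 0 < η := lt_min hδ0 one_pos
  have hη : Real.exp η ≤ 1 / (1 - ε / 2) := by
    calc Real.exp η ≤ Real.exp δ := Real.exp_le_exp.2 (min_le_left _ _)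
      _ = 1 / (1 - ε / 2) := by rw [hδ, Real.exp_neg, Real.exp_log (by linarith), one_div]
  filter_upwards [hq.def (c := (η / 8) ^ 2) (by positivity), eventually_ge_atTop 2] with m hmq hm
  have hm1 : 1 ≤ m := by omega
  have : NeZero m := ⟨by omega⟩
  have : IsCyclotomicExtension {m} ℚ (CyclotomicField m ℚ) := by
    have : NeZero (m : ℚ) := ⟨by exact_mod_cast (show m ≠ 0 by omega)⟩
    -- Two `ℚ`-algebra structures occur on the field; they agree because such a structure is unique.
    rw [show (DivisionRing.toRatAlgebra : Algebra ℚ (CyclotomicField m ℚ)) =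
      CyclotomicField.algebra m ℚ from Subsingleton.elim _ _]
    exact CyclotomicField.isCyclotomicExtension m ℚ
  have hbot : 𝔓 m ≠ ⊥ := by
    intro h
    have hov := (hover m hm1).over
    rw [h, Ideal.under_bot, Ideal.span_singleton_eq_bot] at hov
    exact (hp m hm1).ne_zero (by exact_mod_cast hov)
  refine ⟨?_, CyclotomicLattices.ncard_lineFamily (hprime m hm1) hbot, ?_, ?_⟩
  · rw [CyclotomicLattices.finrank_ambient, IsCyclotomicExtension.Rat.finrank m]
  · rintro _ ⟨C, -, rfl⟩
    exact CyclotomicLattices.isLattice_codeLattice hbot C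
  · refine CyclotomicLattices.exists_line_density (hprime m hm1) hbot hm hε₀ hε₁ hη0
      (min_le_right _ _) hη ?_
    rwa [Real.norm_of_nonneg (by positivity), Real.norm_of_nonneg (by positivity)] at hmq
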